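/- Fix a distinction between sets and classes. A locale $L$ is a set-generated class-locale: a partially ordered class with finite meets and with joins of all subsets, $x\wedge\bigvee U=\bigvee_{y\in U}(x\wedge y)$ for all sets $U\subseteq L$, together with a basis $B_L$, i.e. a set $B_L\subseteq L$ such that $x=\bigvee\{b\in B_L: b\le x\}$ for all $x\in L$. Put $y^*=\bigvee\{c\in B_L: c\wedge y=0\}$ and $y\prec x\iff x\vee y^*=1$. $L$ is compact if every set of basic elements with join $1$ has a finite subset with join $1$, and regular if $a=\bigvee\{b\in B_L:b\prec a\}$ for all $a\in B_L$. A continuous map $f:L\to M$ is a function $f^-:B_M\to L$ with $\bigvee_{a\in B_M} f^-(a)=1$; $f^-(a)\wedge f^-(b)=\bigvee\{f^-(c):c\in B_M,\ c\le a,\ c\le b\}$; and $f^-(a)\le\bigvee_{b\in U}f^-(b)$ whenever $a\in B_M$, $U\subseteq B_M$ is a set and $a\le\bigvee U$. Put $f^-[x]=\bigvee\{f^-(b):b\in B_M,\ b\le x\}$ for $x\in M$, and $(f\circ g)^-(a)=g^-[f^-(a)]$. The map $f$ is dense if $f^-[x]=0$ implies $x=0$, and an embedding if $f^-[\cdot]$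 is onto; a compactification is a dense embedding into a compact regular locale. A relation $R$ is interpolative if $R(x,y)$ implies $R(x,z)$ and $R(z,y)$ for some $z$; $R_0$ denotes the union of all interpolative set-relations contained in $R$. $L$ is strongly regular if there is a family $si$ of subsets of $B_L$ indexed by $B_L$ such that, for all $a\in B_L$, $a=\bigvee si(a)$ and $b\prec_0 a$ for every $b\in si(a)$. A basis $B$ of $L$ is a strongly regular basis if $a=\bigvee\{b\in B:b\prec'_0a\}$ for all $a\in B$, where $\prec'$ is the restriction of $\prec$ to $B$. For $B\subseteq L$, $B^*$ is the subclass of $L$ generated from $B$ by pseudocomplements, finite meets and finite joins. A strong inclusion on a pseudocomplemented distributive lattice $P$ is a set-relation $\lhd$ on $P$ such that: $0\lhd0$ and $1\lhd1$; $x\le a\lhd b\le y$ implies $x\lhd y$; $x\lhd a$ and $x\lhd b$ imply $x\lhd a\wedge b$; $x\lhd a$ and $y\lhd a$ imply $x\vee y\lhd a$; $a\lhd b$ implies $b^*\lhd a^*$; $\lhd\subseteq\prec$; and $\lhd$ is interpolative. For $P\subseteq L$ closed under the operations of $L$, $\lhd$ is compatible with $L$ if $P$ is a basis of $L$ and $a=\bigvee\{x\in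 P:x\lhd a\}$ for all $a\in P$. When $P$ is a set, $\mathcal R(P,\lhd)$ is the locale of ideals $I$ of $P$ such that every $b\in I$ satisfies $b\lhd a$ for some $a\in I$, ordered by inclusion, with basis $\{\{b\in P:b\lhd a\}:a\in P\}$. Theorem. Let $L$ be a strongly regular locale. Let $B$ be a strongly regular basis of $L$, $(f_i:L\to L_i)_{i\in I}$ a (possibly empty) set-indexed family of continuous maps into compact regular locales, and $B_i$ any basis of $L_i$. Put $B_{\mathcal F}=B\cup\bigcup_{i\in I}\{f_i^-[b]:b\in B_i^*\}$, and let $\lhd_\prec$ be the union of all interpolative set-relations on $B_{\mathcal F}^*$ contained in $\prec$. Then: (i) $\lhd_\prec$ is the largest interpolative relation on $B_{\mathcal F}^*$ contained in $\prec$; $B_{\mathcal F}^*$ and $\lhd_\prec$ are sets; and $\lhd_\prec$ is a strong inclusion on $B_{\mathcal F}^*$ compatible with $L$. (ii) There is a continuous map $\mu:L\to\gamma L=\mathcal R(B_{\mathcal F}^*,\lhd_\prec)$ with $\mu^-[I]=\bigvee I$ for every $I\in\gamma L$; it is a compactification of $L$, and for every $i\in I$ there is a unique continuous map $g_i:\gamma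 L\to L_i$ with $g_i\circ\mu=f_i$. In particular, every strongly regular locale has a compactification. -/

import Mathlib

/-!  Conventions: a *class* is a type (in any universe), a *set* is a `u`-small type or a `u`-small
subset of a class.  Thus a set-generated class-locale is a possibly large lattice with joins of all
`u`-small subsets and with a `u`-small basis.  A subset of a `u`-small set is `u`-small.  -/

universe u v w x

/-! ### Interpolative relations -/

/-- `R` interpolates: `R x y` implies `R x z` and `R z y` for some `z`. -/
def Interpolative {A : Type v} (R : A → A → Prop) : Prop :=
  ∀ x y, R x y → ∃ z, R x z ∧ R z y

/-- The union `R₀` of all interpolative set-relations contained in `R`. -/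
def interpolativePart {A : Type v} (R : A → A → Prop) : A → A → Prop := fun x y =>
  ∃ Y : Set (A × A), Small.{u} Y ∧ (∀ p ∈ Y, R p.1 p.2) ∧
    Interpolative (fun a b => (a, b) ∈ Y) ∧ (x, y) ∈ Y

/-! ### Pseudocomplemented distributive lattices and strong inclusions -/

/-- A pseudocomplemented distributive lattice; `bᶜ` is the pseudocomplement. -/
class PCDLattice (P : Type v) extends DistribLattice P, BoundedOrder P, Compl P where
  le_compl_iff : ∀ a b : P, a ≤ bᶜ ↔ a ⊓ b = ⊥

/-- `WellInside y x`, written `y ≺ x` on paper: `1 = x ∨ y*`. -/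
def WellInside {P : Type v} [PCDLattice P] (y x : P) : Prop := x ⊔ yᶜ = ⊤

/-- Strong inclusions on a pcd-lattice. -/
structure IsStrongInclusion {P : Type v} [PCDLattice P] (r : P → P → Prop) : Prop where
  isSet : Small.{u} {p : P × P // r p.1 p.2}
  bot_bot : r ⊥ ⊥
  top_top : r ⊤ ⊤
  mono : ∀ x a b y, x ≤ a → r a b → b ≤ y → r x y
  inf_right : ∀ x a b, r x a → r x b → r x (a ⊓ b)
  sup_left : ∀ x y a, r x a → r y a → r (x ⊔ y) a
  compl : ∀ a b, r a b → r bᶜ aᶜ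
  wellInside : ∀ a b, r a b → WellInside a b
  interpolates : Interpolative r

/-! ### Set-generated class-locales -/

/-- `B` is a basis of `A`: a set of elements such that every `x` is the join of
`D_x = {b ∈ B | b ≤ x}` (which is a set, being contained in `B`). -/
def IsSetBasis {A : Type v} [PartialOrder A] (B : Set A) : Prop :=
  Small.{u} B ∧ ∀ x, IsLUB {b | b ∈ B ∧ b ≤ x} x

/-- A locale: a class-locale (finite meets, joins of all subsets that are sets, binary meets
distributing over these joins) together with a basis. -/
structure Loc : Type (max (u + 1) (v + 1)) where
  carrier : Type v
  [lattice : Lattice carrier]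
  [boundedOrder : BoundedOrder carrier]
  exists_isLUB : ∀ U : Set carrier, Small.{u} U → ∃ s, IsLUB U s
  inf_isLUB : ∀ (x : carrier) (U : Set carrier) (s : carrier), Small.{u} U → IsLUB U s →
    IsLUB ((fun y => x ⊓ y) '' U) (x ⊓ s)
  basis : Set carrier
  isSetBasis : IsSetBasis.{u} basis

namespace Loc

instance : CoeSort Loc.{u, v} (Type v) := ⟨Loc.carrier⟩

attribute [instance] Loc.lattice Loc.boundedOrder

instance (L : Loc.{u, v}) : Small.{u} L.basis := L.isSetBasis.1

/-- The join `⋁ U` of a set `U` of elements of `L`. -/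
noncomputable def join (L : Loc.{u, v}) (U : Set L) (hU : Small.{u} U) : L :=
  (L.exists_isLUB U hU).choose

theorem isLUB_join (L : Loc.{u, v}) (U : Set L) (hU : Small.{u} U) : IsLUB U (L.join U hU) :=
  (L.exists_isLUB U hU).choose_spec

/-- The pseudocomplement `y* = ⋁ {c ∈ B_L | c ∧ y = 0}`. -/
noncomputable def pcompl (L : Loc.{u, v}) (y : L) : L :=
  L.join {c | c ∈ L.basis ∧ c ⊓ y = ⊥} (small_subset (s := L.basis) (Set.sep_subset _ _))

theorem le_pcompl_iff (L : Loc.{u, v}) (a b : L) : a ≤ L.pcompl b ↔ a ⊓ b = ⊥ := by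
  have hs : Small.{u} {c | c ∈ L.basis ∧ c ⊓ b = ⊥} :=
    small_subset (s := L.basis) (Set.sep_subset _ _)
  have hj : IsLUB {c | c ∈ L.basis ∧ c ⊓ b = ⊥} (L.pcompl b) := L.isLUB_join _ hs
  constructor
  · intro h
    have h2 := L.inf_isLUB b _ _ hs hj
    have h3 : b ⊓ L.pcompl b ≤ ⊥ := by
      apply h2.2
      rintro _ ⟨c, hc, rfl⟩
      change b ⊓ c ≤ ⊥
      rw [inf_comm, hc.2]
    exact le_bot_iff.1 ((le_inf inf_le_right (inf_le_left.trans h)).trans h3)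
  · intro h
    apply (L.isSetBasis.2 a).2
    rintro c ⟨hc, hca⟩
    refine hj.1 ⟨hc, le_bot_iff.1 ?_⟩
    exact (inf_le_inf_right b hca).trans h.le

theorem inf_sup_le (L : Loc.{u, v}) (a b c : L) : a ⊓ (b ⊔ c) ≤ a ⊓ b ⊔ a ⊓ c := by
  have h := L.inf_isLUB a {b, c} (b ⊔ c) inferInstance isLUB_pair
  apply h.2
  rintro _ ⟨y, hy, rfl⟩
  rcases hy with rfl | rfl
  · exact le_sup_left
  · exact le_sup_right

/-- Every locale is a pcd-lattice. -/
noncomputable instance (L : Loc.{u, v}) : PCDLattice L where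
  toDistribLattice := DistribLattice.ofInfSupLe L.inf_sup_le
  toBoundedOrder := L.boundedOrder
  compl := L.pcompl
  le_compl_iff := L.le_pcompl_iff

/-- Every covering of `1` by a set of basic elements has a finite subcover. -/
def IsCompact (L : Loc.{u, v}) : Prop :=
  ∀ U : Set L, U ⊆ L.basis → Small.{u} U → IsLUB U ⊤ →
    ∃ V : Set L, V ⊆ U ∧ V.Finite ∧ IsLUB V ⊤

/-- `a = ⋁ {b ∈ B_L | b ≺ a}` for all basic `a`. -/
def IsRegular (L : Loc.{u, v}) : Prop :=
  ∀ a ∈ L.basis, IsLUB {b | b ∈ L.basis ∧ WellInside b a} a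

/-- Strong regularity: there is a family `si : B_L → Pow(B_L)` with `a = ⋁ si(a)`, such that
`b ∈ si(a)` implies that some interpolative set-relation contained in `≺` relates `b` to `a`. -/
def IsStronglyRegular (L : Loc.{u, v}) : Prop :=
  ∃ si : L.basis → Set L.basis, ∀ a : L.basis,
    IsLUB (Subtype.val '' si a) (a : L) ∧
      ∀ b ∈ si a, interpolativePart.{u, v} (WellInside (P := L)) b a

/-- `B` is a strongly regular basis of `L`: a basis with `a = ⋁ {b ∈ B | b ≺₀' a}` for all
`a ∈ B`, where `≺₀'` is the largest interpolative relation on `B` contained in the restriction of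
`≺` to `B`. -/
def IsStronglyRegularBasis (L : Loc.{u, v}) (B : Set L) : Prop :=
  IsSetBasis.{u} B ∧ ∀ a : B,
    IsLUB (Subtype.val ''
      {b : B | interpolativePart.{u, v} (fun x y : B => WellInside (x : L) (y : L)) b a}) (a : L)

/-! ### The pcd-lattice generated by a subset -/

/-- Membership in `B*`: generated from `B` by pseudocomplements, finite meets, finite joins. -/
inductive InStar (L : Loc.{u, v}) (B : Set L) : L → Prop
  | base (b : L) : b ∈ B → InStar L B b
  | compl (a : L) : InStar L B a → InStar L B aᶜ
  | inf (V : Finset L) : (∀ x ∈ V, InStar L B x) → InStar L B (V.inf id)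
  | sup (V : Finset L) : (∀ x ∈ V, InStar L B x) → InStar L B (V.sup id)

/-- `B*` as a subset of `L`. -/
def star (L : Loc.{u, v}) (B : Set L) : Set L := {x | L.InStar B x}

theorem star_bot (L : Loc.{u, v}) (B : Set L) : (⊥ : L) ∈ L.star B :=
  InStar.sup ∅ (by simp)

theorem star_top (L : Loc.{u, v}) (B : Set L) : (⊤ : L) ∈ L.star B :=
  InStar.inf ∅ (by simp)

open Classical in
theorem star_sup (L : Loc.{u, v}) (B : Set L) {x y : L} (hx : x ∈ L.star B) (hy : y ∈ L.star B) :
    x ⊔ y ∈ L.star B := by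
  have h : L.InStar B (({x, y} : Finset L).sup id) := InStar.sup _ (by
    intro z hz
    rcases Finset.mem_insert.1 hz with rfl | hz
    · exact hx
    · rw [Finset.mem_singleton.1 hz]; exact hy)
  rwa [Finset.sup_insert, Finset.sup_singleton] at h

open Classical in
theorem star_inf (L : Loc.{u, v}) (B : Set L) {x y : L} (hx : x ∈ L.star B) (hy : y ∈ L.star B) :
    x ⊓ y ∈ L.star B := by
  have h : L.InStar B (({x, y} : Finset L).inf id) := InStar.inf _ (by
    intro z hz
    rcases Finset.mem_insert.1 hz with rfl | hz
    · exact hx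
    · rw [Finset.mem_singleton.1 hz]; exact hy)
  rwa [Finset.inf_insert, Finset.inf_singleton] at h

/-- `B*` is a pcd-lattice under the order and the operations of `L`. -/
noncomputable instance (L : Loc.{u, v}) (B : Set L) : PCDLattice (L.star B) where
  toLattice := Subtype.lattice (fun _ _ hx hy => L.star_sup B hx hy)
    (fun _ _ hx hy => L.star_inf B hx hy)
  le_sup_inf a b c := le_sup_inf (x := (a : L)) (y := (b : L)) (z := (c : L))
  top := ⟨⊤, L.star_top B⟩
  le_top a := le_top (a := (a : L))
  bot := ⟨⊥, L.star_bot B⟩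
  bot_le a := bot_le (a := (a : L))
  compl a := ⟨(a : L)ᶜ, InStar.compl _ a.2⟩
  le_compl_iff a b := (PCDLattice.le_compl_iff (a : L) (b : L)).trans
    ⟨fun h => Subtype.ext h, fun h => congrArg Subtype.val h⟩

/-- A strong inclusion on `B*` is compatible with `L`: `B*` is a basis of `L` and
`a = ⋁_L {x ∈ B* | x ◁ a}` for all `a ∈ B*`. -/
def IsCompatible (L : Loc.{u, v}) (B : Set L) (r : L.star B → L.star B → Prop) : Prop :=
  IsSetBasis.{u} (L.star B) ∧
    ∀ a : L.star B, IsLUB (Subtype.val '' {x : L.star B | r x a}) (a : L)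

/-! ### Continuous maps -/

/-- Continuous maps `f : L → M`, given by `f⁻ : B_M → L`. -/
@[ext] structure Hom (L : Loc.{u, v}) (M : Loc.{u, w}) where
  inv : M.basis → L
  isLUB_range : IsLUB (Set.range inv) ⊤
  inv_inf : ∀ a b : M.basis,
    IsLUB (inv '' {c | (c : M) ≤ a ∧ (c : M) ≤ b}) (inv a ⊓ inv b)
  inv_le : ∀ (a : M.basis) (U : Set M.basis),
    (a : M) ≤ M.join (Subtype.val '' U) inferInstance → inv a ≤ L.join (inv '' U) inferInstance

namespace Hom

variable {L : Loc.{u, v}} {M : Loc.{u, w}}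

/-- The extension of `f⁻` to all of `M`: `f⁻[a] = ⋁ {f⁻(b) | b ∈ B_M, b ≤ a}`. -/
noncomputable def invExt (f : Hom L M) (a : M) : L :=
  L.join (f.inv '' {b | (b : M) ≤ a}) inferInstance

/-- `f` is dense: `f⁻[a] = 0` implies `a = 0`. -/
def IsDense (f : Hom L M) : Prop := ∀ a : M, f.invExt a = ⊥ → a = ⊥

/-- `f` is an embedding: `f⁻[·]` is onto. -/
def IsEmbedding (f : Hom L M) : Prop := Function.Surjective f.invExt

/-- A (compact regular) compactification: a dense embedding with compact regular codomain. -/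
def IsCompactification (f : Hom L M) : Prop :=
  M.IsCompact ∧ M.IsRegular ∧ f.IsDense ∧ f.IsEmbedding

end Hom

/-- The inverse image function `a ↦ g⁻[f⁻(a)]` of the composite `f ∘ g`. -/
noncomputable def compInv {L : Loc.{u, v}} {M : Loc.{u, w}} {N : Loc.{u, x}}
    (f : Hom M N) (g : Hom L M) : N.basis → L :=
  fun a => g.invExt (f.inv a)

end Loc

/-! ### Round ideals -/

/-- Round ideals of `(P, r)`. -/
structure IsRoundIdeal {P : Type v} [PCDLattice P] (r : P → P → Prop) (I : Set P) : Prop where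
  lower : ∀ a ∈ I, ∀ b, b ≤ a → b ∈ I
  finset_sup : ∀ s : Finset P, (∀ x ∈ s, x ∈ I) → s.sup id ∈ I
  round : ∀ b ∈ I, ∃ a ∈ I, r b a

/-- The class `R(P, r)` of round ideals, ordered by inclusion. -/
def RoundIdeals {P : Type v} [PCDLattice P] (r : P → P → Prop) : Type v :=
  {I : Set P // IsRoundIdeal r I}

namespace RoundIdeals

variable {P : Type v} [PCDLattice P] {r : P → P → Prop}

instance : PartialOrder (RoundIdeals r) := Subtype.partialOrder _

theorem le_of_strong (h : IsStrongInclusion.{u} r) {x y : P} (hxy : r x y) : x ≤ y := by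
  have h1 : y ⊔ xᶜ = ⊤ := h.wellInside _ _ hxy
  have h2 : x ⊓ xᶜ = ⊥ := by rw [inf_comm]; exact (PCDLattice.le_compl_iff _ _).1 le_rfl
  calc x = x ⊓ (y ⊔ xᶜ) := by rw [h1, inf_top_eq]
    _ = x ⊓ y := by rw [inf_sup_left, h2, sup_bot_eq]
    _ ≤ y := inf_le_right

theorem sup_sup (h : IsStrongInclusion.{u} r) {a b c d : P} (hab : r a b) (hcd : r c d) :
    r (a ⊔ c) (b ⊔ d) :=
  h.sup_left _ _ _ (h.mono _ _ _ _ le_rfl hab le_sup_left)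
    (h.mono _ _ _ _ le_rfl hcd le_sup_right)

theorem inf_inf (h : IsStrongInclusion.{u} r) {a b c d : P} (hab : r a b) (hcd : r c d) :
    r (a ⊓ c) (b ⊓ d) :=
  h.inf_right _ _ _ (h.mono _ _ _ _ inf_le_left hab le_rfl)
    (h.mono _ _ _ _ inf_le_right hcd le_rfl)

theorem finset_sup_rel (h : IsStrongInclusion.{u} r) (s : Finset P) (z : P → P)
    (hz : ∀ y ∈ s, r y (z y)) : r (s.sup id) (s.sup z) := by
  classical
  induction s using Finset.induction_on with
  | empty => simpa using h.bot_bot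
  | insert a s _ ih =>
    rw [Finset.sup_insert, Finset.sup_insert]
    exact sup_sup h (hz a (Finset.mem_insert_self _ _))
      (ih fun y hy => hz y (Finset.mem_insert_of_mem hy))

/-- The join of round ideals. -/
def sJoin (h : IsStrongInclusion.{u} r) (U : Set (RoundIdeals r)) : RoundIdeals r :=
  ⟨{x | ∃ s : Finset P, (∀ y ∈ s, ∃ I ∈ U, y ∈ I.1) ∧ x ≤ s.sup id}, by
    classical
    refine ⟨?_, ?_, ?_⟩
    · rintro a ⟨s, hs, ha⟩ b hb
      exact ⟨s, hs, hb.trans ha⟩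
    · intro t ht
      choose! f hf hf' using ht
      refine ⟨t.biUnion f, ?_, ?_⟩
      · intro y hy
        obtain ⟨x, hx, hy⟩ := Finset.mem_biUnion.1 hy
        exact hf x hx y hy
      · refine Finset.sup_le fun x hx => (hf' x hx).trans ?_
        exact Finset.sup_mono (Finset.subset_biUnion_of_mem f hx)
    · rintro b ⟨s, hs, hb⟩
      have hz : ∀ y ∈ s, ∃ z, (∃ I ∈ U, z ∈ I.1) ∧ r y z := by
        intro y hy
        obtain ⟨I, hI, hyI⟩ := hs y hy
        obtain ⟨z, hz, hyz⟩ := I.2.round y hyI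
        exact ⟨z, ⟨I, hI, hz⟩, hyz⟩
      choose! z hz hyz using hz
      refine ⟨s.sup z, ⟨s.image z, ?_, ?_⟩, ?_⟩
      · intro y hy
        obtain ⟨x, hx, rfl⟩ := Finset.mem_image.1 hy
        exact hz x hx
      · rw [Finset.sup_image]; exact le_rfl
      · exact h.mono _ _ _ _ hb (finset_sup_rel h s z hyz) le_rfl⟩

theorem isLUB_sJoin (h : IsStrongInclusion.{u} r) (U : Set (RoundIdeals r)) :
    IsLUB U (sJoin h U) := by
  constructor
  · intro I hI x hx
    exact ⟨{x}, by simpa using ⟨I, hI, hx⟩, by simp⟩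
  · rintro J hJ x ⟨s, hs, hx⟩
    refine J.2.lower _ (J.2.finset_sup s fun y hy => ?_) _ hx
    obtain ⟨I, hI, hy⟩ := hs y hy
    exact hJ hI hy

/-- Binary meets are intersections. -/
def meet (h : IsStrongInclusion.{u} r) (I J : RoundIdeals r) : RoundIdeals r :=
  ⟨I.1 ∩ J.1,
    fun a ha b hb => ⟨I.2.lower a ha.1 b hb, J.2.lower a ha.2 b hb⟩,
    fun s hs => ⟨I.2.finset_sup s fun x hx => (hs x hx).1,
      J.2.finset_sup s fun x hx => (hs x hx).2⟩,
    fun b hb => by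
      obtain ⟨x, hx, hbx⟩ := I.2.round b hb.1
      obtain ⟨y, hy, hby⟩ := J.2.round b hb.2
      exact ⟨x ⊓ y, ⟨I.2.lower _ hx _ inf_le_left, J.2.lower _ hy _ inf_le_right⟩,
        h.inf_right _ _ _ hbx hby⟩⟩

/-- The lattice of round ideals. -/
@[reducible] def lattice (h : IsStrongInclusion.{u} r) : Lattice (RoundIdeals r) where
  sup I J := sJoin h {I, J}
  inf I J := meet h I J
  le_sup_left I J := (isLUB_sJoin h {I, J}).1 (by simp)
  le_sup_right I J := (isLUB_sJoin h {I, J}).1 (by simp)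
  sup_le I J K hI hJ := (isLUB_sJoin h {I, J}).2 (by
    rintro _ (rfl | rfl)
    · exact hI
    · exact hJ)
  inf_le_left I J := fun _ hx => hx.1
  inf_le_right I J := fun _ hx => hx.2
  le_inf I J K hJ hK := fun _ hx => ⟨hJ hx, hK hx⟩

/-- The least and the greatest round ideal. -/
@[reducible] def boundedOrder (h : IsStrongInclusion.{u} r) : BoundedOrder (RoundIdeals r) where
  top := ⟨Set.univ, fun _ _ _ _ => trivial, fun _ _ => trivial,
    fun _ _ => ⟨⊤, trivial, h.mono _ _ _ _ le_top h.top_top le_rfl⟩⟩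
  le_top _ := fun _ _ => trivial
  bot := sJoin h ∅
  bot_le _ := (isLUB_sJoin h ∅).2 (by simp)

/-- The round ideal `⇓a = {b | b ◁ a}`. -/
def down (h : IsStrongInclusion.{u} r) (a : P) : RoundIdeals r :=
  ⟨{b | r b a},
    fun _ hx _ hy => h.mono _ _ _ _ hy hx le_rfl,
    fun s hs => by
      have := finset_sup_rel h s (fun _ => a) hs
      exact h.mono _ _ _ _ le_rfl this (Finset.sup_le fun _ _ => le_rfl),
    fun b hb => by
      obtain ⟨z, hbz, hza⟩ := h.interpolates b a hb
      exact ⟨z, hza, hbz⟩⟩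

end RoundIdeals

/-- The locale `R(P, r)` of round ideals of a pcd-lattice `P` (a set) with a strong inclusion `r`,
with the basis `B_d = {⇓a | a ∈ P}`. -/
noncomputable def roundIdealLocale {P : Type v} [PCDLattice P] (hP : Small.{u} P)
    (r : P → P → Prop) (h : IsStrongInclusion.{u} r) : Loc.{u, v} where
  carrier := RoundIdeals r
  lattice := RoundIdeals.lattice h
  boundedOrder := RoundIdeals.boundedOrder h
  exists_isLUB U _ := ⟨RoundIdeals.sJoin h U, RoundIdeals.isLUB_sJoin h U⟩
  inf_isLUB I U S _ hS := by
    classical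
    obtain rfl := hS.unique (RoundIdeals.isLUB_sJoin h U)
    constructor
    · rintro _ ⟨J, hJ, rfl⟩ x hx
      exact ⟨hx.1, hS.1 hJ hx.2⟩
    · intro K hK x hx
      obtain ⟨hxI, s, hs, hxs⟩ := hx
      have hmem : (s.image fun y => x ⊓ y).sup id ∈ K.1 := by
        apply K.2.finset_sup
        intro y hy
        obtain ⟨z, hz, rfl⟩ := Finset.mem_image.1 hy
        obtain ⟨J, hJ, hzJ⟩ := hs z hz
        exact hK ⟨J, hJ, rfl⟩ ⟨I.2.lower _ hxI _ inf_le_left, J.2.lower _ hzJ _ inf_le_right⟩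
      refine K.2.lower _ hmem _ ?_
      rw [Finset.sup_image]
      calc x ≤ x ⊓ s.sup id := le_inf le_rfl hxs
        _ = s.sup fun y => x ⊓ y := Finset.sup_inf_distrib_left s id x
  basis := Set.range (RoundIdeals.down h)
  isSetBasis := ⟨inferInstance, fun I => by
    constructor
    · rintro J ⟨_, hJ⟩
      exact hJ
    · intro K hK x hx
      obtain ⟨a, ha, hxa⟩ := I.2.round x hx
      have : RoundIdeals.down h a ≤ I := fun y hy =>
        I.2.lower a ha y (RoundIdeals.le_of_strong h hy)
      exact hK ⟨⟨a, rfl⟩, this⟩ hxa⟩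

/-! ### The objects of the theorem -/

/-- `B_F = B ∪ ⋃ᵢ {fᵢ⁻[b] | b ∈ Bᵢ*}`. -/
def familyBasis {L : Loc.{u, v}} {ι : Type u} {K : ι → Loc.{u, w}} (f : ∀ i, Loc.Hom L (K i))
    (B : Set L) (C : ∀ i, Set (K i)) : Set L :=
  B ∪ ⋃ i, (f i).invExt '' (K i).star (C i)

/-- The largest interpolative relation on `B*` contained in `≺`. -/
def maxInclusion (L : Loc.{u, v}) (B : Set L) : L.star B → L.star B → Prop :=
  interpolativePart.{u, v} (fun x y : L.star B => WellInside (x : L) (y : L))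

/-! On a set, the union of all interpolative relations inside `≺` is itself interpolative, so it is
the largest one. A pair therefore lies in it as soon as some interpolative relation inside `≺`
contains the pair (`le_interpolativePart`). Almost everything is proved by exhibiting such a
relation.

This gives the strong inclusion axioms, since closing `◁` under each rule yields an interpolative
relation inside `≺`. It gives compatibility, since the relation witnessing strong regularity of `B`
stays interpolative in any larger generated lattice. It also gives the link with `f : L → K`: when
`K` is compact regular, `≺` interpolates on `C*`, and its image under `f⁻` is an interpolative
relation inside `≺`, so `c ≺ d` implies `f⁻[c] ◁ f⁻[d]`.

Round ideals then form a compact regular locale, and `I ↦ ⋁ I` is dense and onto. A map `f` extends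
by sending `b` to the ideal of all `x ≤ f⁻[c]` with `c ≺ b`. Roundness and preservation of joins
come from compactness, and restriction to `f⁻` from regularity. Density of `μ` gives uniqueness. -/

section InterpolativePart

variable {A : Type v} {R : A → A → Prop}

theorem interpolativePart_le {a b : A} (h : interpolativePart.{u, v} R a b) : R a b := by
  obtain ⟨Y, _, hR, _, hab⟩ := h
  exact hR _ hab

theorem interpolative_interpolativePart : Interpolative (interpolativePart.{u, v} R) := by
  rintro a b ⟨Y, hY, hR, hi, hab⟩
  obtain ⟨z, haz, hzb⟩ := hi a b hab
  exact ⟨z, ⟨Y, hY, hR, hi, haz⟩, ⟨Y, hY, hR, hi, hzb⟩⟩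

/-- Over a small type the graph of `r` is a set, so `r` is one of the relations in the union. This
is the coinduction principle for `◁`. -/
theorem le_interpolativePart [Small.{u} A] {r : A → A → Prop} (hi : Interpolative r)
    (hr : ∀ a b, r a b → R a b) {a b : A} (h : r a b) : interpolativePart.{u, v} R a b :=
  ⟨{p | r p.1 p.2}, inferInstance, fun _ hp => hr _ _ hp, hi, h⟩

end InterpolativePart

/-! ### Well-inside relation and strong inclusions on pcd-lattices -/

section PCDLattice

variable {P : Type v} [PCDLattice P]

theorem inf_pcompl_eq_bot (a : P) : a ⊓ aᶜ = ⊥ := by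
  rw [inf_comm]; exact (PCDLattice.le_compl_iff _ _).1 le_rfl

theorem pcompl_anti {a b : P} (h : a ≤ b) : bᶜ ≤ aᶜ := by
  rw [PCDLattice.le_compl_iff]
  refine le_bot_iff.1 ((inf_le_inf_left _ h).trans ?_)
  rw [inf_comm, inf_pcompl_eq_bot]

theorem le_pcompl_pcompl (a : P) : a ≤ aᶜᶜ := by
  rw [PCDLattice.le_compl_iff, inf_pcompl_eq_bot]

theorem pcompl_bot_eq_top : (⊥ : P)ᶜ = ⊤ :=
  top_le_iff.1 ((PCDLattice.le_compl_iff _ _).2 (by simp))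

namespace WellInside

theorem bot_left (a : P) : WellInside ⊥ a := by
  rw [WellInside, pcompl_bot_eq_top, sup_top_eq]

theorem top_right (a : P) : WellInside a ⊤ := by
  rw [WellInside, top_sup_eq]

theorem mono {x a b y : P} (h₁ : x ≤ a) (h : WellInside a b) (h₂ : b ≤ y) : WellInside x y :=
  top_le_iff.1 (h.ge.trans (sup_le_sup h₂ (pcompl_anti h₁)))

theorem inf_right {x a b : P} (ha : WellInside x a) (hb : WellInside x b) :
    WellInside x (a ⊓ b) := by
  rw [WellInside, sup_inf_right, ha, hb, inf_top_eq]

theorem sup_left {x y a : P} (hx : WellInside x a) (hy : WellInside y a) :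
    WellInside (x ⊔ y) a := by
  have h : xᶜ ⊓ yᶜ ≤ (x ⊔ y)ᶜ := by
    rw [PCDLattice.le_compl_iff, inf_sup_left, sup_eq_bot_iff]
    constructor
    · refine le_bot_iff.1 ((inf_le_inf_right x inf_le_left).trans ?_)
      rw [inf_comm, inf_pcompl_eq_bot]
    · refine le_bot_iff.1 ((inf_le_inf_right y inf_le_right).trans ?_)
      rw [inf_comm, inf_pcompl_eq_bot]
  refine top_le_iff.1 (le_trans ?_ (sup_le_sup_left h a))
  rw [sup_inf_left, hx, hy, inf_top_eq]

theorem compl {a b : P} (h : WellInside a b) : WellInside bᶜ aᶜ := by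
  refine top_le_iff.1 (h.ge.trans ?_)
  rw [sup_comm]
  exact sup_le_sup_left (le_pcompl_pcompl b) _

theorem le {a b : P} (h : WellInside a b) : a ≤ b :=
  calc a = a ⊓ (b ⊔ aᶜ) := by rw [show b ⊔ aᶜ = ⊤ from h, inf_top_eq]
    _ = a ⊓ b := by rw [inf_sup_left, inf_pcompl_eq_bot, sup_bot_eq]
    _ ≤ b := inf_le_right

end WellInside

/-- On a pcd-lattice that is a set, the largest interpolative relation contained in `≺` is a
strong inclusion. -/
theorem isStrongInclusion_interpolativePart [Small.{u} P] :
    IsStrongInclusion.{u} (interpolativePart.{u, v} (WellInside (P := P))) := by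
  have hmono : ∀ x a b y : P, x ≤ a → interpolativePart.{u, v} WellInside a b → b ≤ y →
      interpolativePart.{u, v} WellInside x y := by
    intro x a b y hxa hab hby
    -- Coinduction: the closure of `◁` under the rule is again interpolative and inside `≺`, hence
    -- already contained in `◁`. The other rules follow the same pattern.
    refine le_interpolativePart
      (r := fun x y => ∃ a b, x ≤ a ∧ interpolativePart.{u, v} WellInside a b ∧ b ≤ y) ?_ ?_
      ⟨a, b, hxa, hab, hby⟩
    · rintro x y ⟨a, b, hxa, hab, hby⟩
      obtain ⟨z, haz, hzb⟩ := interpolative_interpolativePart a b hab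
      exact ⟨z, ⟨a, z, hxa, haz, le_rfl⟩, ⟨z, b, le_rfl, hzb, hby⟩⟩
    · rintro x y ⟨a, b, hxa, hab, hby⟩
      exact (interpolativePart_le hab).mono hxa hby
  refine ⟨inferInstance, ?_, ?_, hmono, ?_, ?_, ?_, fun _ _ => interpolativePart_le,
    interpolative_interpolativePart⟩
  · refine le_interpolativePart (r := fun x y => x = ⊥ ∧ y = ⊥) ?_ ?_ ⟨rfl, rfl⟩
    · rintro x y ⟨rfl, rfl⟩
      exact ⟨⊥, ⟨rfl, rfl⟩, rfl, rfl⟩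
    · rintro x y ⟨rfl, rfl⟩
      exact WellInside.bot_left _
  · refine le_interpolativePart (r := fun x y => x = ⊤ ∧ y = ⊤) ?_ ?_ ⟨rfl, rfl⟩
    · rintro x y ⟨rfl, rfl⟩
      exact ⟨⊤, ⟨rfl, rfl⟩, rfl, rfl⟩
    · rintro x y ⟨rfl, rfl⟩
      exact WellInside.top_right _
  · intro x a b ha hb
    refine le_interpolativePart
      (r := fun x c => ∃ a b, c = a ⊓ b ∧ interpolativePart.{u, v} WellInside x a ∧
        interpolativePart.{u, v} WellInside x b) ?_ ?_ ⟨a, b, rfl, ha, hb⟩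
    · rintro x _ ⟨a, b, rfl, ha, hb⟩
      obtain ⟨y, hxy, hya⟩ := interpolative_interpolativePart _ _ ha
      obtain ⟨z, hxz, hzb⟩ := interpolative_interpolativePart _ _ hb
      exact ⟨y ⊓ z, ⟨y, z, rfl, hxy, hxz⟩, a, b, rfl, hmono _ _ _ _ inf_le_left hya le_rfl,
        hmono _ _ _ _ inf_le_right hzb le_rfl⟩
    · rintro x _ ⟨a, b, rfl, ha, hb⟩
      exact (interpolativePart_le ha).inf_right (interpolativePart_le hb)
  · intro x y a hx hy
    refine le_interpolativePart
      (r := fun c a => ∃ x y, c = x ⊔ y ∧ interpolativePart.{u, v} WellInside x a ∧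
        interpolativePart.{u, v} WellInside y a) ?_ ?_ ⟨x, y, rfl, hx, hy⟩
    · rintro _ a ⟨x, y, rfl, hx, hy⟩
      obtain ⟨z, hxz, hza⟩ := interpolative_interpolativePart _ _ hx
      obtain ⟨t, hyt, hta⟩ := interpolative_interpolativePart _ _ hy
      exact ⟨z ⊔ t, ⟨x, y, rfl, hmono _ _ _ _ le_rfl hxz le_sup_left,
        hmono _ _ _ _ le_rfl hyt le_sup_right⟩, z, t, rfl, hza, hta⟩
    · rintro _ a ⟨x, y, rfl, hx, hy⟩
      exact (interpolativePart_le hx).sup_left (interpolativePart_le hy)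
  · intro a b hab
    refine le_interpolativePart
      (r := fun x y => ∃ a b, x = bᶜ ∧ y = aᶜ ∧ interpolativePart.{u, v} WellInside a b) ?_ ?_
      ⟨a, b, rfl, rfl, hab⟩
    · rintro _ _ ⟨a, b, rfl, rfl, hab⟩
      obtain ⟨z, haz, hzb⟩ := interpolative_interpolativePart _ _ hab
      exact ⟨zᶜ, ⟨z, b, rfl, rfl, hzb⟩, a, z, rfl, rfl, haz⟩
    · rintro _ _ ⟨a, b, rfl, rfl, hab⟩
      exact (interpolativePart_le hab).compl

end PCDLattice

namespace Loc

/-! ### Joins in class-locales -/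

section Joins

variable {L : Loc.{u, v}}

theorem inf_le_of_isLUB {U : Set L} [hU : Small.{u} U] {x s k : L} (hs : IsLUB U s)
    (h : ∀ y ∈ U, x ⊓ y ≤ k) : x ⊓ s ≤ k := by
  apply (L.inf_isLUB x U s hU hs).2
  rintro _ ⟨y, hy, rfl⟩
  exact h y hy

theorem inf_le_of_isLUB_of_isLUB {U V : Set L} [Small.{u} U] [Small.{u} V] {s t k : L}
    (hs : IsLUB U s) (ht : IsLUB V t) (h : ∀ x ∈ U, ∀ y ∈ V, x ⊓ y ≤ k) : s ⊓ t ≤ k := by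
  refine inf_le_of_isLUB ht fun y hy => ?_
  rw [inf_comm]
  refine inf_le_of_isLUB hs fun x hx => ?_
  rw [inf_comm]
  exact h x hx y hy

theorem isLUB_basis_subtype (a : L) :
    IsLUB (Subtype.val '' {b : L.basis | (b : L) ≤ a}) a := by
  convert L.isSetBasis.2 a using 1
  ext b
  simp [and_comm]

theorem small_sep_basis {B : Set L} (hB : Small.{u} B) (p : L → Prop) :
    Small.{u} {b | b ∈ B ∧ p b} :=
  small_subset (s := B) (Set.sep_subset _ _)

end Joins

/-! ### Generated pcd-lattices -/

/-- Terms in the operations generating `B*`. -/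
inductive StarTerm (X : Type u) : Type u
  | base : X → StarTerm X
  | compl : StarTerm X → StarTerm X
  | bot : StarTerm X
  | top : StarTerm X
  | inf : StarTerm X → StarTerm X → StarTerm X
  | sup : StarTerm X → StarTerm X → StarTerm X

/-- The value of a term. -/
noncomputable def StarTerm.eval {X : Type u} {L : Loc.{u, v}} (e : X → L) : StarTerm X → L
  | base b => e b
  | compl t => (t.eval e)ᶜ
  | bot => ⊥
  | top => ⊤
  | inf s t => s.eval e ⊓ t.eval e
  | sup s t => s.eval e ⊔ t.eval e

/-- Every element of `B*` is the value of a finite term over a copy of `B` in `Type u`, and these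
terms themselves form a type in `Type u`. -/
theorem small_star (L : Loc.{u, v}) (B : Set L) [Small.{u} B] : Small.{u} (L.star B) := by
  classical
  let e : Shrink.{u} B → L := fun b => ((equivShrink B).symm b : L)
  have h : L.star B ⊆ Set.range (StarTerm.eval (L := L) e) := by
    intro x hx
    induction hx with
    | base b hb => exact ⟨.base (equivShrink B ⟨b, hb⟩), by simp [StarTerm.eval, e]⟩
    | compl a _ ih =>
      obtain ⟨t, rfl⟩ := ih
      exact ⟨.compl t, rfl⟩
    | inf V hV ih =>
      induction V using Finset.induction_on with
      | empty => exact ⟨.top, rfl⟩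
      | insert a V _ ih' =>
        obtain ⟨s, hs⟩ := ih a (Finset.mem_insert_self _ _)
        obtain ⟨t, ht⟩ := ih' (fun x hx => hV x (Finset.mem_insert_of_mem hx))
          (fun x hx => ih x (Finset.mem_insert_of_mem hx))
        exact ⟨.inf s t, by rw [Finset.inf_insert, ← ht, id, ← hs]; rfl⟩
    | sup V hV ih =>
      induction V using Finset.induction_on with
      | empty => exact ⟨.bot, rfl⟩
      | insert a V _ ih' =>
        obtain ⟨s, hs⟩ := ih a (Finset.mem_insert_self _ _)
        obtain ⟨t, ht⟩ := ih' (fun x hx => hV x (Finset.mem_insert_of_mem hx))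
          (fun x hx => ih x (Finset.mem_insert_of_mem hx))
        exact ⟨.sup s t, by rw [Finset.sup_insert, ← ht, id, ← hs]; rfl⟩
  exact small_subset h

theorem subset_star (L : Loc.{u, v}) (B : Set L) : B ⊆ L.star B := fun b hb => .base b hb

theorem wellInside_star {L : Loc.{u, v}} {B : Set L} (x y : L.star B) :
    WellInside x y ↔ WellInside (x : L) (y : L) :=
  ⟨fun h => congrArg Subtype.val h, fun h => Subtype.ext h⟩

theorem maxInclusion_eq (L : Loc.{u, v}) (B : Set L) :
    maxInclusion L B = interpolativePart.{u, v} (WellInside (P := L.star B)) := by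
  unfold maxInclusion
  congr 1
  ext x y
  exact (wellInside_star x y).symm

theorem isStrongInclusion_maxInclusion (L : Loc.{u, v}) (B : Set L) [Small.{u} B] :
    IsStrongInclusion.{u} (maxInclusion L B) := by
  have := L.small_star B
  rw [maxInclusion_eq]
  exact isStrongInclusion_interpolativePart

theorem isGreatest_maxInclusion (L : Loc.{u, v}) (B : Set L) [Small.{u} B] :
    IsGreatest {r : L.star B → L.star B → Prop |
      Interpolative r ∧ ∀ x y, r x y → WellInside (x : L) (y : L)} (maxInclusion L B) := by
  have := L.small_star B
  exact ⟨⟨interpolative_interpolativePart, fun _ _ => interpolativePart_le⟩,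
    fun r hr x y hxy => le_interpolativePart hr.1 hr.2 hxy⟩

theorem coe_finset_sup_le {L : Loc.{u, v}} {B : Set L} {k : L} (s : Finset (L.star B))
    (h : ∀ x ∈ s, (x : L) ≤ k) : ((s.sup id : L.star B) : L) ≤ k :=
  Finset.sup_induction (p := fun x : L.star B => (x : L) ≤ k) (bot_le (α := L))
    (fun _ ha _ hb => sup_le (α := L) ha hb) h

/-! ### Compactness and regularity -/

section CompactRegular

variable {K : Loc.{u, v}}

/-- Compactness speaks of basic covers only. A general cover is refined by the basic elements below
its members, and each element of the finite subcover is replaced by a member above it. -/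
theorem IsCompact.exists_finset (hK : K.IsCompact) {U : Set K} [Small.{u} U] (hU : IsLUB U ⊤) :
    ∃ s : Finset K, ↑s ⊆ U ∧ s.sup id = ⊤ := by
  classical
  obtain ⟨V, hVU, hV, hVtop⟩ := hK {b | b ∈ K.basis ∧ ∃ u ∈ U, b ≤ u} (fun _ h => h.1)
    (small_sep_basis inferInstance _) ⟨fun _ _ => le_top, fun k hk => hU.2 fun u hu =>
      (K.isSetBasis.2 u).2 fun b hb => hk ⟨hb.1, u, hu, hb.2⟩⟩
  choose! f hf hf' using fun b (hb : b ∈ V) => (hVU hb).2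
  refine ⟨hV.toFinset.image f, ?_, top_le_iff.1 (hVtop.2 fun b hb => ?_)⟩
  · intro y hy
    obtain ⟨b, hb, rfl⟩ := Finset.mem_image.1 (Finset.mem_coe.1 hy)
    exact hf b (hV.mem_toFinset.1 hb)
  · exact (hf' b hb).trans
      (Finset.le_sup (f := id) (Finset.mem_image_of_mem f (hV.mem_toFinset.2 hb)))

/-- If `c ≺ ⋁ U` in a compact locale then `c` is covered by finitely many elements of `U`, in the
sense that `c ≺ ⋁ s` for some finite `s ⊆ U`. -/
theorem IsCompact.exists_finset_wellInside (hK : K.IsCompact) {U : Set K} [Small.{u} U] {c d : K}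
    (hU : IsLUB U d) (h : WellInside c d) : ∃ s : Finset K, ↑s ⊆ U ∧ WellInside c (s.sup id) := by
  classical
  -- `c ≺ d` says exactly that `U` together with `c*` covers `1`; the element `c*` is removed again
  -- from the finite subcover.
  have hlub : IsLUB (insert cᶜ U) ⊤ := by
    have := hU.insert cᶜ
    rwa [sup_comm, show d ⊔ cᶜ = ⊤ from h] at this
  have : Small.{u} ↑(insert cᶜ U) := small_insert _ _
  obtain ⟨s, hsU, hs⟩ := hK.exists_finset hlub
  refine ⟨s.erase cᶜ, ?_, ?_⟩
  · intro x hx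
    have hx := Finset.mem_erase.1 (Finset.mem_coe.1 hx)
    exact (hsU hx.2).resolve_left hx.1
  · refine top_le_iff.1 (hs.ge.trans (Finset.sup_le fun x hx => ?_))
    by_cases hxc : x = cᶜ
    · exact hxc.le.trans le_sup_right
    · exact (Finset.le_sup (f := id) (Finset.mem_erase.2 ⟨hxc, hx⟩)).trans le_sup_left

/-- Regularity passes from the given basis to an arbitrary one, because `c ≤ d ≺ b ≤ x` implies `c ≺
x`. -/
theorem IsRegular.isLUB_wellInside (hK : K.IsRegular) {C : Set K} (hC : IsSetBasis.{u} C) (x : K) :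
    IsLUB {c | c ∈ C ∧ WellInside c x} x := by
  refine ⟨fun c hc => hc.2.le, fun k hk => (K.isSetBasis.2 x).2 fun b hb => ?_⟩
  refine (hK b hb.1).2 fun d hd => (hC.2 d).2 fun c hc => hk ⟨hc.1, ?_⟩
  exact hd.2.mono hc.2 hb.2

theorem WellInside.finset_sup_left {s : Finset K} {d : K} (h : ∀ x ∈ s, WellInside x d) :
    WellInside (s.sup id) d :=
  Finset.sup_induction (p := fun x => WellInside x d) (WellInside.bot_left d)
    (fun _ ha _ hb => ha.sup_left hb) h

/-- The element `d` is the join of the elements of `C` well inside it, and compactness reduces this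
to a finite join, which interpolates. That join need not lie in `C`, which is why `C*` appears. -/
theorem IsCompact.interpolative_star (hK : K.IsCompact) (hr : K.IsRegular) {C : Set K}
    (hC : IsSetBasis.{u} C) : Interpolative (fun x y : K.star C => WellInside (x : K) (y : K)) := by
  rintro ⟨c, hc⟩ ⟨d, hd⟩ h
  have := small_sep_basis hC.1 (fun c => WellInside c d)
  obtain ⟨s, hs, hcs⟩ := hK.exists_finset_wellInside (hr.isLUB_wellInside hC d) h
  exact ⟨⟨s.sup id, .sup s fun x hx => .base x (hs hx).1⟩, hcs,
    WellInside.finset_sup_left fun x hx => (hs hx).2⟩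

end CompactRegular

/-! ### Continuous maps as frame homomorphisms -/

namespace Hom

variable {L : Loc.{u, v}} {M : Loc.{u, w}}

section InvExt

variable (f : Hom L M)

theorem isLUB_invExt (a : M) : IsLUB (f.inv '' {b | (b : M) ≤ a}) (f.invExt a) :=
  L.isLUB_join _ _

theorem inv_le_invExt {b : M.basis} {a : M} (h : (b : M) ≤ a) : f.inv b ≤ f.invExt a :=
  (f.isLUB_invExt a).1 ⟨b, h, rfl⟩

theorem invExt_mono {a b : M} (h : a ≤ b) : f.invExt a ≤ f.invExt b := by
  apply (f.isLUB_invExt a).2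
  rintro _ ⟨c, hc, rfl⟩
  exact f.inv_le_invExt (le_trans hc h)

/-- The covering axiom for `f⁻` is applied to the basic elements lying below some member of `U`. -/
theorem isLUB_image_invExt {U : Set M} [Small.{u} U] {s : M} (hs : IsLUB U s) :
    IsLUB (f.invExt '' U) (f.invExt s) := by
  constructor
  · rintro _ ⟨u, hu, rfl⟩
    exact f.invExt_mono (hs.1 hu)
  · intro k hk
    apply (f.isLUB_invExt s).2
    rintro _ ⟨b, hb, rfl⟩
    let V : Set M.basis := {c | ∃ u ∈ U, (c : M) ≤ u}
    have hV := M.isLUB_join (Subtype.val '' V) inferInstance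
    have hbV : (b : M) ≤ M.join (Subtype.val '' V) inferInstance := by
      refine le_trans hb (hs.2 fun u hu => (isLUB_basis_subtype u).2 ?_)
      rintro _ ⟨c, hc, rfl⟩
      exact hV.1 ⟨c, ⟨u, hu, hc⟩, rfl⟩
    refine (f.inv_le b V hbV).trans ((L.isLUB_join _ _).2 ?_)
    rintro _ ⟨c, ⟨u, hu, hcu⟩, rfl⟩
    exact (f.inv_le_invExt hcu).trans (hk ⟨u, hu, rfl⟩)

theorem invExt_coe (b : M.basis) : f.invExt b = f.inv b := by
  refine le_antisymm ((f.isLUB_invExt b).2 ?_) (f.inv_le_invExt le_rfl)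
  rintro _ ⟨c, hc, rfl⟩
  have h := f.inv_le c {b} (by
    refine le_trans hc ((M.isLUB_join _ _).1 ⟨b, rfl, rfl⟩))
  refine h.trans ((L.isLUB_join _ _).2 ?_)
  rintro _ ⟨_, rfl, rfl⟩
  exact le_rfl

theorem invExt_top : f.invExt ⊤ = ⊤ :=
  top_le_iff.1 (f.isLUB_range.2 (by
    rintro _ ⟨b, rfl⟩
    exact f.inv_le_invExt le_top))

theorem invExt_bot : f.invExt ⊥ = ⊥ := by
  have h := f.isLUB_image_invExt (isLUB_empty (α := M))
  rw [Set.image_empty] at h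
  exact h.unique isLUB_empty

theorem invExt_sup (a b : M) : f.invExt (a ⊔ b) = f.invExt a ⊔ f.invExt b := by
  have h := f.isLUB_image_invExt (isLUB_pair (a := a) (b := b))
  rw [Set.image_pair] at h
  exact h.unique isLUB_pair

theorem invExt_inf (a b : M) : f.invExt (a ⊓ b) = f.invExt a ⊓ f.invExt b := by
  refine le_antisymm (le_inf (f.invExt_mono inf_le_left) (f.invExt_mono inf_le_right)) ?_
  refine inf_le_of_isLUB_of_isLUB (f.isLUB_invExt a) (f.isLUB_invExt b) ?_
  rintro _ ⟨c, hc, rfl⟩ _ ⟨d, hd, rfl⟩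
  apply (f.inv_inf c d).2
  rintro _ ⟨e, he, rfl⟩
  exact f.inv_le_invExt (le_inf (he.1.trans hc) (he.2.trans hd))

theorem invExt_finset_sup_le {s : Finset M} {k : L} (h : ∀ x ∈ s, f.invExt x ≤ k) :
    f.invExt (s.sup id) ≤ k :=
  Finset.sup_induction (p := fun x => f.invExt x ≤ k) (by rw [invExt_bot]; exact bot_le)
    (fun _ ha _ hb => by rw [invExt_sup]; exact sup_le ha hb) h

theorem wellInside_invExt {a b : M} (h : WellInside a b) :
    WellInside (f.invExt a) (f.invExt b) := by
  have h₁ : f.invExt aᶜ ≤ (f.invExt a)ᶜ := by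
    rw [PCDLattice.le_compl_iff]
    have := f.invExt_inf aᶜ a
    rw [(PCDLattice.le_compl_iff aᶜ a).1 le_rfl, f.invExt_bot] at this
    exact this.symm
  have h₂ := f.invExt_sup b aᶜ
  rw [show b ⊔ aᶜ = ⊤ from h, f.invExt_top] at h₂
  exact top_le_iff.1 (h₂.le.trans (sup_le_sup_left h₁ _))

end InvExt

/-- A map preserving finite meets and joins of sets is a continuous map in the other direction. -/
def ofMap (φ : M → L) (top : φ ⊤ = ⊤) (inf : ∀ a b, φ (a ⊓ b) = φ a ⊓ φ b)
    (lub : ∀ (U : Set M) (s : M), Small.{u} U → IsLUB U s → IsLUB (φ '' U) (φ s)) : Hom L M where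
  inv b := φ b
  isLUB_range := by
    have h := lub _ _ inferInstance (isLUB_basis_subtype (⊤ : M))
    rw [top, Set.image_image] at h
    convert h using 1
    ext
    simp
  inv_inf a b := by
    have h := lub _ _ inferInstance (isLUB_basis_subtype ((a : M) ⊓ b))
    rw [inf, Set.image_image] at h
    convert h using 1
    ext
    simp
  inv_le a U h := by
    have hU := M.isLUB_join (Subtype.val '' U) inferInstance
    have hmono : ∀ {x y : M}, x ≤ y → φ x ≤ φ y := fun {x y} hxy => by
      rw [← inf_eq_left, ← inf, inf_eq_left.2 hxy]
    refine (hmono h).trans ((lub _ _ inferInstance hU).2 ?_)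
    rintro _ ⟨_, ⟨b, hb, rfl⟩, rfl⟩
    exact (L.isLUB_join _ _).1 ⟨b, hb, rfl⟩

theorem invExt_ofMap (φ : M → L) (top : φ ⊤ = ⊤) (inf : ∀ a b, φ (a ⊓ b) = φ a ⊓ φ b)
    (lub : ∀ (U : Set M) (s : M), Small.{u} U → IsLUB U s → IsLUB (φ '' U) (φ s)) (a : M) :
    (ofMap φ top inf lub).invExt a = φ a := by
  have h := lub _ _ inferInstance (isLUB_basis_subtype a)
  rw [Set.image_image] at h
  exact ((ofMap φ top inf lub).isLUB_invExt a).unique h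

theorem invExt_invExt_of_compInv_eq {N : Loc.{u, x}} {g : Hom M N} {m : Hom L M} {f : Hom L N}
    (h : compInv g m = f.inv) (a : N) : m.invExt (g.invExt a) = f.invExt a := by
  have h₁ := m.isLUB_image_invExt (g.isLUB_invExt a)
  rw [Set.image_image] at h₁
  refine h₁.unique ?_
  have h₂ := f.isLUB_invExt a
  rw [← h] at h₂
  exact h₂

/-- Maps into a regular locale are determined by their composite with a dense map. -/
theorem eq_of_comp_dense {N : Loc.{u, x}} (hN : N.IsRegular) {m : Hom L M} (hm : m.IsDense)
    {f : Hom L N} {g h : Hom M N} (hg : compInv g m = f.inv) (hh : compInv h m = f.inv) :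
    g = h := by
  have key : ∀ {g h : Hom M N}, compInv g m = f.inv → compInv h m = f.inv →
      ∀ b, g.inv b ≤ h.inv b := by
    intro g h hg hh b
    rw [← g.invExt_coe, ← h.invExt_coe]
    have := small_sep_basis (L := N) (B := N.basis) inferInstance (fun c => WellInside c b)
    apply (g.isLUB_image_invExt (hN.isLUB_wellInside N.isSetBasis (b : N))).2
    rintro _ ⟨c, ⟨-, hc⟩, rfl⟩
    -- Density: pulled back along `m`, this meet becomes `f⁻[c ∧ c*] = 0`.
    have h₀ : g.invExt c ⊓ h.invExt cᶜ = ⊥ := by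
      apply hm
      rw [m.invExt_inf, invExt_invExt_of_compInv_eq hg, invExt_invExt_of_compInv_eq hh,
        ← f.invExt_inf, inf_pcompl_eq_bot, f.invExt_bot]
    have h₁ : h.invExt b ⊔ h.invExt cᶜ = ⊤ := by
      have := h.invExt_sup (b : N) cᶜ
      rw [show (b : N) ⊔ cᶜ = ⊤ from hc, h.invExt_top] at this
      exact this.symm
    calc g.invExt c = g.invExt c ⊓ (h.invExt b ⊔ h.invExt cᶜ) := by rw [h₁, inf_top_eq]
      _ ≤ g.invExt c ⊓ h.invExt b ⊔ g.invExt c ⊓ h.invExt cᶜ := M.inf_sup_le _ _ _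
      _ ≤ h.invExt b := by rw [h₀, sup_bot_eq]; exact inf_le_right
  ext b
  exact le_antisymm (key hg hh b) (key hh hg b)

end Hom

end Loc

/-! ### The locale of round ideals -/

namespace RoundIdeals

variable {P : Type v} [PCDLattice P] {r : P → P → Prop} (hP : Small.{u} P)
  (h : IsStrongInclusion.{u} r)

/-- That `1` belongs to a join of ideals is witnessed by finitely many elements, each taken from one
ideal. -/
theorem isCompact_roundIdealLocale : (roundIdealLocale hP r h).IsCompact := by
  intro U _ _ hU
  have hU' : ∀ S : RoundIdeals r, S ∈ upperBounds U → ⊤ ∈ S.1 := fun S hS => hU.2 hS trivial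
  obtain ⟨s, hs, htop⟩ := hU' _ (isLUB_sJoin h U).1
  have : Nonempty (RoundIdeals r) := ⟨sJoin h U⟩
  choose! f hfU hf using hs
  refine ⟨f '' (s : Set P), ?_, s.finite_toSet.image f, ⟨fun _ _ => fun _ _ => trivial, ?_⟩⟩
  · rintro _ ⟨y, hy, rfl⟩
    exact hfU y hy
  · intro K hK x _
    have hle : ∀ y ∈ s, f y ≤ (show RoundIdeals r from K) := fun y hy => hK ⟨y, hy, rfl⟩
    exact K.2.lower _ (K.2.finset_sup s fun y hy => hle y hy (hf y hy)) _ (le_top.trans htop)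

/-- Interpolate twice, `b ◁ c ◁ d ◁ a`. Then `d ∈ ⇓a`, and `c* ∈ ⇓b* ⊆ (⇓b)*`, while `d ∨ c* = 1`
because `c ≺ d`. -/
theorem wellInside_down {a b : P} (hba : r b a) :
    WellInside (P := roundIdealLocale hP r h) (down h b) (down h a) := by
  obtain ⟨d, hbd, hda⟩ := h.interpolates _ _ hba
  obtain ⟨c, hbc, hcd⟩ := h.interpolates _ _ hbd
  have hcompl : (show (roundIdealLocale hP r h) from down h bᶜ) ≤
      (show (roundIdealLocale hP r h) from down h b)ᶜ := by
    rw [PCDLattice.le_compl_iff]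
    refine le_bot_iff.1 fun x hx => ?_
    have h₁ : x ≤ bᶜ := le_of_strong h hx.1
    have h₂ : x ≤ b := le_of_strong h hx.2
    have hx : x = ⊥ := le_bot_iff.1
      ((le_inf h₂ h₁).trans (inf_pcompl_eq_bot b).le)
    exact ⟨∅, by simp, by simp [hx]⟩
  refine top_le_iff.1 (le_trans ?_ (sup_le_sup_left hcompl _))
  intro x _
  classical
  refine ⟨{d, cᶜ}, ?_, ?_⟩
  · intro y hy
    rcases Finset.mem_insert.1 hy with rfl | hy
    · exact ⟨down h a, by simp, hda⟩
    · rw [Finset.mem_singleton.1 hy]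
      exact ⟨down h bᶜ, by simp, h.compl _ _ hbc⟩
  · have hdc : d ⊔ cᶜ = ⊤ := h.wellInside _ _ hcd
    rw [Finset.sup_insert, Finset.sup_singleton, id, id, hdc]
    exact le_top

theorem isRegular_roundIdealLocale : (roundIdealLocale hP r h).IsRegular := by
  rintro _ ⟨a, rfl⟩
  refine ⟨fun J hJ => hJ.2.le, fun K hK x hx => ?_⟩
  obtain ⟨b, hxb, hba⟩ := h.interpolates x a hx
  have hle : down h b ≤ (show RoundIdeals r from K) :=
    hK ⟨⟨b, rfl⟩, wellInside_down hP h hba⟩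
  exact hle hxb

end RoundIdeals

namespace Loc

open RoundIdeals

/-! ### The compactification given by a compatible strong inclusion -/

section Compactification

variable {L : Loc.{u, v}} {B : Set L} (hP : Small.{u} (L.star B))
  {r : L.star B → L.star B → Prop} (hs : IsStrongInclusion.{u} r)

theorem small_coe_roundIdeal (hP : Small.{u} (L.star B)) (I : RoundIdeals r) :
    Small.{u} ↑(Subtype.val '' I.1) := by
  have : Small.{u} ↑I.1 := small_subset I.1.subset_univ
  infer_instance

/-- The join in `L` of a round ideal of `B*`. -/
noncomputable def idealJoin (I : RoundIdeals r) : L :=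
  L.join (Subtype.val '' I.1) (small_coe_roundIdeal hP I)

theorem isLUB_idealJoin (I : RoundIdeals r) : IsLUB (Subtype.val '' I.1) (L.idealJoin hP I) :=
  L.isLUB_join _ _

theorem le_idealJoin {I : RoundIdeals r} {x : L.star B} (hx : x ∈ I.1) :
    (x : L) ≤ L.idealJoin hP I :=
  (isLUB_idealJoin hP I).1 ⟨x, hx, rfl⟩

/-- The map `μ : L → R(B*, r)` with `μ⁻[I] = ⋁ I`. -/
noncomputable def toRoundIdeals : Hom L (roundIdealLocale hP r hs) :=
  Hom.ofMap (M := roundIdealLocale hP r hs) (L.idealJoin hP)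
    (top_le_iff.1 (le_idealJoin hP (x := ⊤) trivial))
    (by
      intro I J
      apply le_antisymm
      · apply (isLUB_idealJoin hP _).2
        rintro _ ⟨x, hx, rfl⟩
        exact le_inf (le_idealJoin hP hx.1) (le_idealJoin hP hx.2)
      · have := small_coe_roundIdeal hP I
        have := small_coe_roundIdeal hP J
        refine inf_le_of_isLUB_of_isLUB (isLUB_idealJoin hP I) (isLUB_idealJoin hP J) ?_
        rintro _ ⟨x, hx, rfl⟩ _ ⟨y, hy, rfl⟩
        refine le_idealJoin hP (I := meet hs I J) (x := x ⊓ y) ⟨?_, ?_⟩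
        · exact I.2.lower _ hx _ inf_le_left
        · exact J.2.lower _ hy _ inf_le_right)
    (by
      intro U S _ hS
      obtain rfl : S = sJoin hs U := hS.unique (isLUB_sJoin hs U)
      constructor
      · rintro _ ⟨I, hI, rfl⟩
        apply (isLUB_idealJoin hP I).2
        rintro _ ⟨x, hx, rfl⟩
        exact le_idealJoin hP ((isLUB_sJoin hs U).1 hI hx)
      · intro k hk
        apply (isLUB_idealJoin hP _).2
        rintro _ ⟨x, ⟨s, hsU, hx⟩, rfl⟩
        refine le_trans (b := ((s.sup id : L.star B) : L)) hx (coe_finset_sup_le s fun y hy => ?_)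
        obtain ⟨I, hI, hy⟩ := hsU y hy
        exact (le_idealJoin hP hy).trans (hk ⟨I, hI, rfl⟩))

theorem invExt_toRoundIdeals (I : RoundIdeals r) :
    (toRoundIdeals hP hs).invExt I = L.idealJoin hP I :=
  Hom.invExt_ofMap (M := roundIdealLocale hP r hs) _ _ _ _ I

/-- Dense, since an ideal with join `0` contains only `0`. Onto, since by compatibility `x` is the
join of the round ideal of all `a` with `a ◁ b ≤ x` for some `b`. -/
theorem isCompactification_toRoundIdeals (hc : L.IsCompatible B r) :
    (toRoundIdeals hP hs).IsCompactification := by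
  refine ⟨isCompact_roundIdealLocale hP hs, isRegular_roundIdealLocale hP hs, ?_, ?_⟩
  · intro I hI
    replace hI := (invExt_toRoundIdeals hP hs I).symm.trans hI
    refine le_bot_iff.1 fun x hx => ?_
    have : x = ⊥ := Subtype.ext (le_bot_iff.1 ((le_idealJoin hP hx).trans hI.le))
    exact ⟨∅, by simp, by simp [this]⟩
  · intro x
    let I : RoundIdeals r := ⟨{a | ∃ b : L.star B, r a b ∧ (b : L) ≤ x}, by
      refine ⟨?_, ?_, ?_⟩
      · rintro a ⟨b, hab, hb⟩ c hca
        exact ⟨b, hs.mono _ _ _ _ hca hab le_rfl, hb⟩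
      · intro s hsx
        choose! f hf hf' using hsx
        refine ⟨s.sup f, finset_sup_rel hs s f hf, ?_⟩
        exact Finset.sup_induction (p := fun y : L.star B => (y : L) ≤ x) (bot_le (α := L))
          (fun _ ha _ hb => sup_le (α := L) ha hb) hf'
      · rintro a ⟨b, hab, hb⟩
        obtain ⟨c, hac, hcb⟩ := hs.interpolates _ _ hab
        exact ⟨c, ⟨b, hcb, hb⟩, hac⟩⟩
    refine ⟨I, (invExt_toRoundIdeals hP hs I).trans ((isLUB_idealJoin hP I).unique ⟨?_, ?_⟩)⟩
    · rintro _ ⟨a, ⟨b, hab, hb⟩, rfl⟩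
      exact le_trans (b := (b : L)) (le_of_strong hs hab) hb
    · intro k hk
      refine (hc.1.2 x).2 fun b hb => (hc.2 ⟨b, hb.1⟩).2 ?_
      rintro _ ⟨a, ha, rfl⟩
      exact hk ⟨a, ⟨⟨b, hb.1⟩, ha, hb.2⟩, rfl⟩

end Compactification

/-- The interpolative relation on `B` stays interpolative when viewed in `A*`, so it lies in the
largest one there. Adjoining further elements to `B` is therefore harmless. -/
theorem IsStronglyRegularBasis.isCompatible {L : Loc.{u, v}} {B A : Set L}
    (hB : L.IsStronglyRegularBasis B) (hBA : B ⊆ A) [Small.{u} A] :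
    L.IsCompatible A (maxInclusion L A) := by
  have hsmall := L.small_star A
  have hs := L.isStrongInclusion_maxInclusion A
  refine ⟨⟨hsmall, fun x => ⟨fun b hb => hb.2, fun k hk => (hB.1.2 x).2 fun b hb =>
    hk ⟨L.subset_star A (hBA hb.1), hb.2⟩⟩⟩, fun a => ⟨?_, fun k hk => ?_⟩⟩
  · rintro _ ⟨x, hx, rfl⟩
    exact le_of_strong hs hx
  · refine (hB.1.2 a).2 fun b hb => (hB.2 ⟨b, hb.1⟩).2 ?_
    rintro _ ⟨c, hc, rfl⟩
    let e : B → L.star A := fun x => ⟨x, L.subset_star A (hBA x.2)⟩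
    refine hk ⟨e c, hs.mono _ _ _ _ le_rfl (le_interpolativePart
      (r := fun x y => ∃ p q : B, x = e p ∧ y = e q ∧
        interpolativePart.{u, v} (fun x y : B => WellInside (x : L) (y : L)) p q) ?_ ?_
      ⟨c, ⟨b, hb.1⟩, rfl, rfl, hc⟩) hb.2, rfl⟩
    · rintro _ _ ⟨p, q, rfl, rfl, hpq⟩
      obtain ⟨t, hpt, htq⟩ := interpolative_interpolativePart _ _ hpq
      exact ⟨e t, ⟨p, t, rfl, rfl, hpt⟩, t, q, rfl, rfl, htq⟩
    · rintro _ _ ⟨p, q, rfl, rfl, hpq⟩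
      exact interpolativePart_le (R := fun x y : B => WellInside (x : L) (y : L)) hpq

/-! ### Extending maps into compact regular locales -/

section Extension

variable {L : Loc.{u, v}} {B : Set L} [Small.{u} B] {K : Loc.{u, w}} {C : Set K}

/-- The image under `f⁻` of `≺` on `C*` is interpolative and inside `≺`. The interpolants are images
of elements of `C*`, so all of these must lie in `B*`. -/
theorem maxInclusion_invExt (hK : K.IsCompact) (hr : K.IsRegular) (hC : IsSetBasis.{u} C)
    (f : Hom L K) (hf : ∀ c ∈ K.star C, f.invExt c ∈ L.star B) (c d : K.star C)
    (hcd : WellInside (c : K) (d : K)) :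
    maxInclusion L B ⟨f.invExt c, hf c c.2⟩ ⟨f.invExt d, hf d d.2⟩ := by
  have := L.small_star B
  refine le_interpolativePart
    (r := fun x y : L.star B => ∃ c d : K.star C, WellInside (c : K) (d : K) ∧
      (x : L) = f.invExt c ∧ (y : L) = f.invExt d) ?_ ?_ ⟨c, d, hcd, rfl, rfl⟩
  · rintro x y ⟨c, d, hcd, hx, hy⟩
    obtain ⟨e, hce, hed⟩ := hK.interpolative_star hr hC c d hcd
    exact ⟨⟨f.invExt e, hf e e.2⟩, ⟨c, e, hce, hx, rfl⟩, e, d, hed, rfl, hy⟩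
  · rintro x y ⟨c, d, hcd, hx, hy⟩
    rw [hx, hy]
    exact f.wellInside_invExt hcd

theorem isRoundIdeal_extension (hK : K.IsCompact) (hr : K.IsRegular) (hC : IsSetBasis.{u} C)
    (f : Hom L K) (hf : ∀ c ∈ K.star C, f.invExt c ∈ L.star B) (b : K) :
    IsRoundIdeal (maxInclusion L B) {x : L.star B | ∃ c ∈ K.star C, WellInside c b ∧ (x : L) ≤ f.invExt c} := by
  refine ⟨?_, ?_, ?_⟩
  · rintro x ⟨c, hc, hcb, hx⟩ y hy
    exact ⟨c, hc, hcb, le_trans (α := L) hy hx⟩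
  · intro s hs
    classical
    choose! c hc hcb hx using hs
    refine ⟨(s.image c).sup id, .sup _ ?_, WellInside.finset_sup_left ?_,
      coe_finset_sup_le s fun x hxs => (hx x hxs).trans (f.invExt_mono
        (Finset.le_sup (f := id) (Finset.mem_image_of_mem c hxs)))⟩
    · intro y hy
      obtain ⟨x, hx, rfl⟩ := Finset.mem_image.1 hy
      exact hc x hx
    · intro y hy
      obtain ⟨x, hx, rfl⟩ := Finset.mem_image.1 hy
      exact hcb x hx
  · rintro x ⟨c, hc, hcb, hx⟩
    have := small_sep_basis hC.1 (fun d => WellInside d b)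
    -- Roundness: `c ≺ ⋁ s ≺ b`, so `x ≤ f⁻[c] ◁ f⁻[⋁ s]`.
    obtain ⟨s, hs, hcs⟩ := hK.exists_finset_wellInside (hr.isLUB_wellInside hC b) hcb
    have hsC : s.sup id ∈ K.star C := .sup s fun y hy => .base y (hs hy).1
    exact ⟨⟨f.invExt (s.sup id), hf _ hsC⟩,
      ⟨s.sup id, hsC, WellInside.finset_sup_left fun y hy => (hs hy).2, le_rfl⟩,
      (L.isStrongInclusion_maxInclusion B).mono _ _ _ _ hx
        (maxInclusion_invExt hK hr hC f hf ⟨c, hc⟩ ⟨_, hsC⟩ hcs) le_rfl⟩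

variable (hK : K.IsCompact) (hr : K.IsRegular) (hC : IsSetBasis.{u} C)
    (f : Hom L K) (hf : ∀ c ∈ K.star C, f.invExt c ∈ L.star B)

/-- The round ideal `{x | x ≤ f⁻[c] for some c ≺ b}`. -/
def extensionIdeal (b : K) : RoundIdeals (maxInclusion L B) :=
  ⟨_, isRoundIdeal_extension hK hr hC f hf b⟩

/-- The extension to `R(B*, ◁)` of a map into a compact regular locale. -/
noncomputable def extension (hP : Small.{u} (L.star B))
    (hs : IsStrongInclusion.{u} (maxInclusion L B)) :
    Hom (roundIdealLocale hP (maxInclusion L B) hs) K :=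
  Hom.ofMap (L := roundIdealLocale hP (maxInclusion L B) hs) (extensionIdeal hK hr hC f hf)
    (by
      refine top_le_iff.1 fun x _ => ?_
      exact ⟨⊤, K.star_top C, WellInside.top_right _, by rw [f.invExt_top]; exact le_top⟩)
    (by
      intro a b
      apply le_antisymm
      · rintro x ⟨c, hc, hcb, hx⟩
        exact ⟨⟨c, hc, hcb.mono le_rfl inf_le_left, hx⟩,
          ⟨c, hc, hcb.mono le_rfl inf_le_right, hx⟩⟩
      · rintro x ⟨⟨c, hc, hca, hxc⟩, ⟨d, hd, hdb, hxd⟩⟩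
        refine ⟨c ⊓ d, K.star_inf C hc hd, (hca.mono inf_le_left le_rfl).inf_right
          (hdb.mono inf_le_right le_rfl), ?_⟩
        rw [f.invExt_inf]
        exact le_inf hxc hxd)
    (by
      intro U s _ hU
      constructor
      · rintro _ ⟨a, ha, rfl⟩ x ⟨c, hc, hca, hx⟩
        exact ⟨c, hc, hca.mono le_rfl (hU.1 ha), hx⟩
      · rintro J hJ x ⟨c, hc, hcs, hx⟩
        classical
        have := small_sep_basis hC.1 (fun d => ∃ a ∈ U, WellInside d a)
        -- Covering `s` by elements of `C` well inside members of `U` ensures that each `f⁻[d]` lies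
        -- in the ideal of some `a ∈ U`, hence in `J`.
        have hlub : IsLUB {d | d ∈ C ∧ ∃ a ∈ U, WellInside d a} s := by
          refine ⟨?_, fun k hk => hU.2 fun a ha => (hr.isLUB_wellInside hC a).2 fun d hd =>
            hk ⟨hd.1, a, ha, hd.2⟩⟩
          rintro d ⟨_, a, ha, hda⟩
          exact hda.le.trans (hU.1 ha)
        obtain ⟨t, ht, hct⟩ := hK.exists_finset_wellInside hlub hcs
        -- The default `⊥` is never met, since `e` is only used on `t ⊆ C`.
        let e : K → L.star B := fun d => if hd : d ∈ K.star C then ⟨f.invExt d, hf d hd⟩ else ⊥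
        have he : ∀ d ∈ t, (e d : L) = f.invExt d := fun d hd => by
          have : d ∈ K.star C := .base d (ht hd).1
          simp [e, this]
        refine J.2.lower _ (J.2.finset_sup (t.image e) ?_) _ ?_
        · intro y hy
          obtain ⟨d, hd, rfl⟩ := Finset.mem_image.1 hy
          obtain ⟨hdC, a, ha, hda⟩ := ht hd
          have hle : extensionIdeal hK hr hC f hf a ≤ (show RoundIdeals (maxInclusion L B) from J) :=
            hJ ⟨a, ha, rfl⟩
          exact hle ⟨d, .base d hdC, hda, (he d hd).le⟩
        · refine le_trans (α := L) hx ((f.invExt_mono hct.le).trans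
            (f.invExt_finset_sup_le fun d hd => ?_))
          rw [← he d hd]
          exact Finset.le_sup (f := id) (Finset.mem_image_of_mem e hd))

/-- By regularity `b` is the join of the `c ∈ C` with `c ≺ b`, and `f⁻` preserves this join. -/
theorem compInv_extension (hP : Small.{u} (L.star B))
    (hs : IsStrongInclusion.{u} (maxInclusion L B)) :
    compInv (extension hK hr hC f hf hP hs) (toRoundIdeals hP hs) = f.inv := by
  funext b
  refine (invExt_toRoundIdeals hP hs _).trans ((isLUB_idealJoin hP _).unique ⟨?_, ?_⟩)
  · rintro _ ⟨x, ⟨c, _, hcb, hx⟩, rfl⟩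
    rw [← f.invExt_coe]
    exact hx.trans (f.invExt_mono hcb.le)
  · intro k hk
    rw [← f.invExt_coe]
    have := small_sep_basis hC.1 (fun d => WellInside d b)
    apply (f.isLUB_image_invExt (hr.isLUB_wellInside hC (b : K))).2
    rintro _ ⟨c, ⟨hcC, hcb⟩, rfl⟩
    exact hk ⟨⟨f.invExt c, hf c (.base c hcC)⟩, ⟨c, .base c hcC, hcb, le_rfl⟩, rfl⟩

end Extension

theorem small_familyBasis {L : Loc.{u, v}} {ι : Type u} {K : ι → Loc.{u, w}}
    (f : ∀ i, Hom L (K i)) {B : Set L} (hB : Small.{u} B) {C : ∀ i, Set (K i)}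
    (hC : ∀ i, Small.{u} (C i)) : Small.{u} (familyBasis f B C) := by
  have := fun i => (K i).small_star (C i)
  unfold familyBasis
  infer_instance

/-! ### Existence of strongly regular bases -/

/-- Choose an interpolative set-relation for every pair `b ∈ si(a)` and adjoin the elements
occurring in these relations to `B_L`; only set-many are added. -/
theorem IsStronglyRegular.exists_basis {L : Loc.{u, v}} (hL : L.IsStronglyRegular) :
    ∃ B, L.IsStronglyRegularBasis B := by
  obtain ⟨si, hsi⟩ := hL
  choose Y hY hYR hYi hYab using fun p : {p : L.basis × L.basis // p.2 ∈ si p.1} =>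
    (hsi p.1.1).2 p.1.2 p.2
  -- Second coordinates suffice: an interpolant `z` of `(x, d)` occurs in the pair `(x, z)`.
  let B : Set L := L.basis ∪ ⋃ p, Prod.snd '' Y p
  have hBsmall : Small.{u} B := by
    have : ∀ p, Small.{u} ↑(Y p) := hY
    infer_instance
  have hsnd : ∀ p, ∀ z ∈ Y p, z.2 ∈ B := fun p z hz =>
    Or.inr (Set.mem_iUnion.2 ⟨p, z, hz, rfl⟩)
  refine ⟨B, ⟨hBsmall, fun x => ⟨fun b hb => hb.2, fun k hk => (L.isSetBasis.2 x).2 fun b hb =>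
    hk ⟨Or.inl hb.1, hb.2⟩⟩⟩, fun a => ⟨?_, fun k hk => ?_⟩⟩
  · rintro _ ⟨b, hb, rfl⟩
    exact (interpolativePart_le (R := fun x y : B => WellInside (x : L) (y : L)) hb).le
  · refine (L.isSetBasis.2 a).2 fun b hb => ((hsi ⟨b, hb.1⟩).1).2 ?_
    rintro _ ⟨c, hc, rfl⟩
    let p : {p : L.basis × L.basis // p.2 ∈ si p.1} := ⟨(⟨b, hb.1⟩, c), hc⟩
    let e : B := ⟨c, Or.inl c.2⟩
    have hea : interpolativePart.{u, v} (fun x y : B => WellInside (x : L) (y : L)) e a := by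
      -- The relation is closed upwards on the right because `Y p` reaches only the basic `b ≤ a`,
      -- not the possibly non-basic `a`.
      refine le_interpolativePart (r := fun x y : B => ∃ d : L, ((x : L), d) ∈ Y p ∧ d ≤ y) ?_ ?_
        ⟨b, hYab p, hb.2⟩
      · rintro x y ⟨d, hxd, hdy⟩
        obtain ⟨z, hxz, hzd⟩ := hYi p _ _ hxd
        exact ⟨⟨z, hsnd p _ hxz⟩, ⟨z, hxz, le_rfl⟩, d, hzd, hdy⟩
      · rintro x y ⟨d, hxd, hdy⟩
        exact WellInside.mono le_rfl (hYR p _ hxd) hdy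
    exact hk ⟨e, hea, rfl⟩

end Loc

/-! ### The compactification theorem -/

theorem theorem4 (L : Loc.{u, v}) (hL : L.IsStronglyRegular) :
    (∀ (ι : Type u) (K : ι → Loc.{u, w}) (_hc : ∀ i, (K i).IsCompact)
        (_hr : ∀ i, (K i).IsRegular) (f : ∀ i, Loc.Hom L (K i))
        (B : Set L) (_hB : L.IsStronglyRegularBasis B)
        (C : ∀ i, Set (K i)) (_hC : ∀ i, IsSetBasis.{u} (C i)),
      IsGreatest {r : L.star (familyBasis f B C) → L.star (familyBasis f B C) → Prop |
          Interpolative r ∧ ∀ x y, r x y → WellInside (x : L) (y : L)}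
        (maxInclusion L (familyBasis f B C)) ∧
      ∃ (hP : Small.{u} (L.star (familyBasis f B C)))
        (hs : IsStrongInclusion.{u} (maxInclusion L (familyBasis f B C))),
        L.IsCompatible (familyBasis f B C) (maxInclusion L (familyBasis f B C)) ∧
        ∃ μ : Loc.Hom L (roundIdealLocale hP (maxInclusion L (familyBasis f B C)) hs),
          (∀ I : RoundIdeals (maxInclusion L (familyBasis f B C)),
            IsLUB (Subtype.val '' I.1) (μ.invExt I)) ∧
          μ.IsCompactification ∧
          ∀ i, ∃! g : Loc.Hom (roundIdealLocale hP (maxInclusion L (familyBasis f B C)) hs) (K i),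
            Loc.compInv g μ = (f i).inv) ∧
    ∃ (M : Loc.{u, v}) (k : Loc.Hom L M), k.IsCompactification := by
  constructor
  · intro ι K hK hr f B hB C hC
    have := Loc.small_familyBasis f hB.1.1 fun i => (hC i).1
    have hP := L.small_star (familyBasis f B C)
    have hs := L.isStrongInclusion_maxInclusion (familyBasis f B C)
    have hc := hB.isCompatible (A := familyBasis f B C) Set.subset_union_left
    refine ⟨L.isGreatest_maxInclusion _, hP, hs, hc, Loc.toRoundIdeals hP hs, fun I => ?_,
      Loc.isCompactification_toRoundIdeals hP hs hc, fun i => ?_⟩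
    · rw [Loc.invExt_toRoundIdeals]
      exact Loc.isLUB_idealJoin hP I
    · have hf : ∀ c ∈ (K i).star (C i), (f i).invExt c ∈ L.star (familyBasis f B C) := fun c h =>
        L.subset_star _ (Or.inr (Set.mem_iUnion.2 ⟨i, c, h, rfl⟩))
      have hg := Loc.compInv_extension (hK i) (hr i) (hC i) (f i) hf hP hs
      exact ⟨_, hg, fun h hh => Loc.Hom.eq_of_comp_dense (hr i)
        (Loc.isCompactification_toRoundIdeals hP hs hc).2.2.1 hh hg⟩
  · obtain ⟨B, hB⟩ := hL.exists_basis
    have := hB.1.1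
    have hc := hB.isCompatible (A := B) subset_rfl
    exact ⟨_, _, Loc.isCompactification_toRoundIdeals (L.small_star B)
      (L.isStrongInclusion_maxInclusion B) hc⟩
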